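/- Let $d,p\ge 1$ be integers and let $f:\mathbb{R}^d\to[0,\infty)$ be a (Borel measurable) probability density. Write $G(t)=\{x\in\mathbb{R}^d: f(x)\ge t\}$, and let $\|\cdot\|$ be the Euclidean norm. Assume: (G) for every $t\in[l,u]$ the level set $G(t)$ is compact, nonempty and not convex; (A) $-\infty<l\le u<\sup f<\infty$; there are $\zeta>0$ and a bounded open set $U\subset\mathbb{R}^d$ such that $G(u+\zeta)$ is bounded, $\overline{G(l-\zeta)}\setminus \operatorname{int}G(u+\zeta)\subset U$ and $f\in C^p(U)$; and there are constants $m>0$ and $k$ with $\|\nabla f(x)\|\ge m$ and $\|\nabla f(x)-\nabla f(y)\|\le k\|x-y\|$ for all $x,y\in U$; (K) $K:\mathbb{R}^d\to\mathbb{R}$ is continuous with bounded support and finite total variation (that is, $\sup\int K\operatorname{div}\varphi<\infty$ over all compactly supported $C^1$ vector fields $\varphi$ with $\|\varphi\|\le 1$), and is a kernel of order at least $p$: $\int K=1$ and $\int z^\alpha K(z)\,dz=0$ for all multi-indices $\alpha$ with $1\le|\alpha|<p$; the bandwidths $h=h_n>0$ are of the exact order $(\log n/n)^{1/(d+2p)}$;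 (K') either $K\ge 0$, or $f$ is uniformly continuous on $\mathbb{R}^d\setminus G(l)$. Then there is a constant $M_0>0$ such that for every $M\ge M_0$ the following holds with $D_n=M(\log n/n)^{p/(d+2p)}$. Let $X_1,X_2,\dots$ be independent random vectors with density $f$, let $\mathcal{X}_n=\{X_1,\dots,X_n\}$, let $$f_n(x)=\frac{1}{nh^d}\sum_{i=1}^n K\Big(\frac{x-X_i}{h}\Big),\qquad \mathcal{X}_n^+(t)=\{X\in\mathcal{X}_n: f_n(X)\ge t+D_n\}.$$ Then for every $\epsilon>0$, $$\mathbb{P}\Big(\sup_{t\in[l,u]} d_H\big(G(t),\mathcal{X}_n^+(t)\big)\le\epsilon\ \text{ for all sufficiently large } n\Big)=1,$$ where $d_H$ is the Hausdorff distance, with $d_H(A,\emptyset)=\infty$ for $A\neq\emptyset$ (so the claim includes that all the sets $\mathcal{X}_n^+(t)$, $t\in[l,u]$, are nonempty for all large $n$). -/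

import Mathlib

open MeasureTheory ProbabilityTheory Filter Set

noncomputable section

namespace LevelSetEstimation

/-- `ℝ^d` with the Euclidean norm. -/
abbrev Space (d : ℕ) : Type := EuclideanSpace ℝ (Fin d)

/-- `f` is a (Borel measurable) probability density on `ℝ^d`. -/
structure IsDensity {d : ℕ} (f : Space d → ℝ) : Prop where
  measurable : Measurable f
  nonneg : ∀ x, 0 ≤ f x
  lintegral_eq_one : ∫⁻ x, ENNReal.ofReal (f x) = 1

/-- The probability distribution with density `f`. -/
def densityLaw {d : ℕ} (f : Space d → ℝ) : Measure (Space d) :=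
  volume.withDensity fun x => ENNReal.ofReal (f x)

/-- The level set `G(t) = {x : f(x) ≥ t}`. -/
def levelSet {d : ℕ} (f : Space d → ℝ) (t : ℝ) : Set (Space d) :=
  {x | t ≤ f x}

/-- The regularity assumption on the density `f` around the levels in `[l, u]`. -/
structure RegularLevels {d : ℕ} (f : Space d → ℝ) (p : ℕ) (l u : ℝ) : Prop where
  le : l ≤ u
  bddAbove : BddAbove (range f)
  lt_sup : u < ⨆ x, f x
  smooth : ∃ (ζ : ℝ) (U : Set (Space d)) (m k : ℝ),
    0 < ζ ∧ IsOpen U ∧ Bornology.IsBounded U ∧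
    Bornology.IsBounded (levelSet f (u + ζ)) ∧
    closure (levelSet f (l - ζ)) \ interior (levelSet f (u + ζ)) ⊆ U ∧
    ContDiffOn ℝ p f U ∧
    0 < m ∧ (∀ x ∈ U, m ≤ ‖gradient f x‖) ∧
    (∀ x ∈ U, ∀ y ∈ U, ‖gradient f x - gradient f y‖ ≤ k * ‖x - y‖)

/-- The divergence `∑ᵢ ∂ᵢ φᵢ` of a vector field. -/
def divergence {d : ℕ} (φ : Space d → Space d) (x : Space d) : ℝ :=
  ∑ i, fderiv ℝ φ x (EuclideanSpace.single i 1) i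

/-- Finite total variation on `ℝ^d`: the integrals `∫ K div φ`, over all `C¹` vector fields `φ`
with compact support and `|φ| ≤ 1`, are bounded (used for continuous `K` with bounded support). -/
def HasFiniteVariation {d : ℕ} (K : Space d → ℝ) : Prop :=
  ∃ V : ℝ, ∀ φ : Space d → Space d, ContDiff ℝ 1 φ → HasCompactSupport φ →
    (∀ x, ‖φ x‖ ≤ 1) → ∫ x, K x * divergence φ x ≤ V

/-- `K` integrates to one and its moments of total degree `1, …, p - 1` vanish: a kernel of order
at least `p` (for kernels that are continuous with bounded support, so that all moments exist). -/
def HasOrderAtLeast {d : ℕ} (K : Space d → ℝ) (p : ℕ) : Prop :=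
  ∫ z, K z = 1 ∧
    ∀ α : Fin d → ℕ, 0 < ∑ i, α i → ∑ i, α i < p → ∫ z, (∏ i, z i ^ α i) * K z = 0

/-- A continuous kernel of order at least `p` with bounded support and finite variation. -/
structure IsAdmissibleKernel {d : ℕ} (K : Space d → ℝ) (p : ℕ) : Prop where
  continuous : Continuous K
  order : HasOrderAtLeast K p
  bounded_support : Bornology.IsBounded (Function.support K)
  finite_variation : HasFiniteVariation K

/-- The bandwidth sequence `h` is positive and of the exact order `(log n / n)^{1/(d+2p)}`. -/
def IsAdmissibleBandwidth (d p : ℕ) (h : ℕ → ℝ) : Prop :=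
  (∀ᶠ n in atTop, 0 < h n) ∧
    Asymptotics.IsTheta atTop h
      (fun n : ℕ => (Real.log n / n) ^ ((1 : ℝ) / ((d : ℝ) + 2 * (p : ℝ))))

/-- The sequence `D_n = M (log n / n)^{p/(d+2p)}`. -/
def thresholdShift (d p : ℕ) (M : ℝ) (n : ℕ) : ℝ :=
  M * (Real.log n / n) ^ ((p : ℝ) / ((d : ℝ) + 2 * (p : ℝ)))

/-- The kernel density estimator `x ↦ (n h^d)⁻¹ ∑_{i < n} K((x - x_i) / h)` built from the first
`n` points of the sequence `x_0, x_1, …`. -/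
def kernelEstimator {d : ℕ} (K : Space d → ℝ) (h : ℝ) (n : ℕ) (pts : ℕ → Space d)
    (x : Space d) : ℝ :=
  ((n : ℝ) * h ^ d)⁻¹ * ∑ i ∈ Finset.range n, K (h⁻¹ • (x - pts i))

/-- The subsample of those among the first `n` points at which the kernel density estimator
is at least `t + D`. -/
def plusSample {d : ℕ} (K : Space d → ℝ) (h : ℝ) (D : ℝ) (n : ℕ) (pts : ℕ → Space d) (t : ℝ) :
    Set (Space d) :=
  {x | (∃ i < n, pts i = x) ∧ t + D ≤ kernelEstimator K h n pts x}

end LevelSetEstimation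

end

namespace LevelSetEstimation

/-! Since `ε` is fixed, no rate is needed: `D_n ≥ 0` and `D_n → 0` suffice, and the estimator
matters only at the `n` sample points. There a Bernstein bound, conditional on the point, has
exponent of order `n h^d`, which dominates a power of `n`. A union bound and Borel–Cantelli then
replace the estimator by its mean `smoothed K f h`, uniformly over the sample.

Two inclusions remain. If `x` is farther than `ε` from `G(t)`, gradient ascent forces `f ≤ t - c` at
`x` (`exists_forall_le_sub`), and smoothing keeps the mean below `t` by a fixed margin
(`eventually_smoothed_add_le`), so `x` is not selected. Conversely, ascent from a point of `G(t)`
reaches a nearby open set where `f > t + c`, and the sample visits it. Compactness leaves finitely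
many sample points to control, so pointwise convergence of the mean is enough; Lebesgue
differentiation gives it even where `f` is discontinuous (`eventually_exists_close_sample`). -/

/-! ### Exponential inequalities and hitting probabilities for independent samples -/

/-- Bernstein's argument: `e^x ≤ 1 + x + x²` for `|x| ≤ 1`, then `1 + y ≤ e^y`. -/
lemma integral_exp_mul_le {E : Type*} [MeasurableSpace E] {ν : Measure E} [IsProbabilityMeasure ν]
    {g : E → ℝ} (hg : Measurable g) {B V c : ℝ} (hB : ∀ y, |g y| ≤ B)
    (hV : ∫ y, g y ^ 2 ∂ν ≤ V) (hc : 0 ≤ c) (hcB : c * B ≤ 1) :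
    ∫ y, Real.exp (c * g y) ∂ν ≤ Real.exp (c * ∫ y, g y ∂ν + c ^ 2 * V) := by
  have hi : Integrable g ν := .of_bound hg.aestronglyMeasurable B (.of_forall hB)
  have hi2 : Integrable (fun y => g y ^ 2) ν :=
    .of_bound (hg.pow_const 2).aestronglyMeasurable (B ^ 2) (.of_forall fun y => by
      rw [Real.norm_eq_abs, abs_pow]
      exact pow_le_pow_left₀ (abs_nonneg _) (hB y) 2)
  have hb : ∀ y, |c * g y| ≤ 1 := fun y => by
    rw [abs_mul, abs_of_nonneg hc]
    exact (mul_le_mul_of_nonneg_left (hB y) hc).trans hcB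
  calc ∫ y, Real.exp (c * g y) ∂ν ≤ ∫ y, (1 + c * g y + c ^ 2 * g y ^ 2) ∂ν := by
        refine integral_mono_of_nonneg (.of_forall fun y => (Real.exp_pos _).le)
          (((integrable_const 1).add (hi.const_mul c)).add (hi2.const_mul _)) (.of_forall fun y => ?_)
        have := (abs_le.1 (Real.abs_exp_sub_one_sub_id_le (hb y))).2
        simp only
        nlinarith
    _ = 1 + (c * ∫ y, g y ∂ν + c ^ 2 * ∫ y, g y ^ 2 ∂ν) := by
        have h1 : Integrable (fun y => 1 + c * g y) ν := (integrable_const 1).add (hi.const_mul c)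
        rw [integral_add h1 (hi2.const_mul _),
          integral_add (integrable_const 1) (hi.const_mul c), integral_const_mul,
          integral_const_mul]
        simp [add_assoc]
    _ ≤ 1 + (c * ∫ y, g y ∂ν + c ^ 2 * V) := by gcongr
    _ ≤ _ := by rw [add_comm]; exact Real.add_one_le_exp _

/-- Chernoff bound. `V` is kept apart from `B` because for the rescaled kernel `V` is of order `h^d`
while `B` stays fixed. -/
lemma measure_sum_sub_integral_ge_le {Ω E : Type*} [MeasurableSpace Ω] [MeasurableSpace E]
    {P : Measure Ω} [IsProbabilityMeasure P] {ν : Measure E} [IsProbabilityMeasure ν]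
    {X : ℕ → Ω → E} (hX : ∀ i, Measurable (X i)) (hmap : ∀ i, P.map (X i) = ν)
    (hind : iIndepFun X P) {g : E → ℝ} (hg : Measurable g) {B V c : ℝ} (hB : ∀ y, |g y| ≤ B)
    (hV : ∫ y, g y ^ 2 ∂ν ≤ V) (hc : 0 ≤ c) (hcB : c * B ≤ 1) (S : Finset ℕ) (s : ℝ) :
    P {ω | s ≤ ∑ j ∈ S, (g (X j ω) - ∫ y, g y ∂ν)}
      ≤ ENNReal.ofReal (Real.exp (-c * s + S.card * (c ^ 2 * V))) := by
  set a := ∫ y, g y ∂ν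
  let Y : ℕ → Ω → ℝ := fun j ω => g (X j ω) - a
  have hY : ∀ j, Measurable (Y j) := fun j => (hg.comp (hX j)).sub_const a
  have hYi : iIndepFun Y P := hind.comp (fun _ y => g y - a) fun _ => hg.sub_const a
  have hYb : ∀ j ω, |Y j ω| ≤ B + |a| := fun j ω =>
    (abs_sub _ _).trans (by gcongr; exact hB _)
  have hmgf : ∀ j, mgf (Y j) P c ≤ Real.exp (c ^ 2 * V) := fun j => by
    have h1 : mgf (Y j) P c = Real.exp (-(c * a)) * ∫ y, Real.exp (c * g y) ∂ν := by
      have hm : Measurable fun y => Real.exp (c * g y) := Real.measurable_exp.comp (hg.const_mul c)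
      rw [mgf, ← hmap j, integral_map (hX j).aemeasurable hm.aestronglyMeasurable,
        ← integral_const_mul]
      refine integral_congr_ae (.of_forall fun ω => ?_)
      simp only [Y]
      rw [← Real.exp_add]
      ring_nf
    rw [h1]
    calc _ ≤ Real.exp (-(c * a)) * Real.exp (c * a + c ^ 2 * V) := by
          gcongr; exact integral_exp_mul_le hg hB hV hc hcB
      _ = _ := by rw [← Real.exp_add]; ring_nf
  have hint : Integrable (fun ω => Real.exp (c * (∑ j ∈ S, Y j) ω)) P := by
    have hm : Measurable (∑ j ∈ S, Y j) := by
      rw [Finset.sum_fn]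
      exact Finset.measurable_sum _ fun j _ => hY j
    refine .of_bound (Real.measurable_exp.comp (hm.const_mul c)).aestronglyMeasurable
      (Real.exp (c * (S.card * (B + |a|)))) (.of_forall fun ω => ?_)
    rw [Real.norm_eq_abs, abs_of_pos (Real.exp_pos _)]
    gcongr
    rw [Finset.sum_apply, ← nsmul_eq_mul]
    exact Finset.sum_le_card_nsmul _ _ _ fun j _ => (le_abs_self _).trans (hYb j ω)
  have key := measure_ge_le_exp_mul_mgf (X := ∑ j ∈ S, Y j) (μ := P) s hc hint
  rw [hYi.mgf_sum hY] at key
  have h2 : ∏ j ∈ S, mgf (Y j) P c ≤ Real.exp (S.card * (c ^ 2 * V)) := by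
    rw [Real.exp_nat_mul]
    exact (Finset.prod_le_prod (fun _ _ => mgf_nonneg) fun j _ => hmgf j).trans_eq (by simp)
  rw [ENNReal.le_ofReal_iff_toReal_le (measure_ne_top _ _) (Real.exp_pos _).le, Real.exp_add]
  refine le_trans (le_of_eq ?_) (key.trans (mul_le_mul_of_nonneg_left h2 (Real.exp_pos _).le))
  simp [Measure.real, Y]

/-- As `i ∉ S`, `X i` is independent of the family indexed by `S`; by Fubini the random centre can
be frozen at `x`, and the bound for fixed `x` does not depend on `x`. -/
lemma measure_sum_sub_integral_sample_ge_le {Ω E : Type*} [MeasurableSpace Ω] [MeasurableSpace E]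
    {P : Measure Ω} [IsProbabilityMeasure P] {ν : Measure E} [IsProbabilityMeasure ν]
    {X : ℕ → Ω → E} (hX : ∀ i, Measurable (X i)) (hmap : ∀ i, P.map (X i) = ν)
    (hind : iIndepFun X P) {φ : E → E → ℝ} (hφ : Measurable (Function.uncurry φ)) {B V c : ℝ}
    (hB : ∀ x y, |φ x y| ≤ B) (hV : ∀ x, ∫ y, φ x y ^ 2 ∂ν ≤ V) (hc : 0 ≤ c) (hcB : c * B ≤ 1)
    {i : ℕ} {S : Finset ℕ} (hi : i ∉ S) (s : ℝ) :
    P {ω | s ≤ ∑ j ∈ S, (φ (X i ω) (X j ω) - ∫ y, φ (X i ω) y ∂ν)}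
      ≤ ENNReal.ofReal (Real.exp (-c * s + S.card * (c ^ 2 * V))) := by
  let T : Ω → (S → E) := fun ω j => X j ω
  have hT : Measurable T := measurable_pi_lambda _ fun j => hX j
  have hm : Measurable fun x => ∫ y, φ x y ∂ν :=
    (hφ.stronglyMeasurable.integral_prod_right).measurable
  let W : Set (E × (S → E)) := {q | s ≤ ∑ j : S, (φ q.1 (q.2 j) - ∫ y, φ q.1 y ∂ν)}
  have hW : MeasurableSet W := by
    refine measurableSet_le measurable_const (Finset.measurable_sum _ fun j _ => ?_)
    refine Measurable.sub (hφ.comp (g := Function.uncurry φ) (f := fun q : E × (S → E) =>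
      (q.1, q.2 j)) ?_) (hm.comp measurable_fst)
    exact measurable_fst.prodMk ((measurable_pi_apply j).comp measurable_snd)
  have hXT : IndepFun (X i) T P := by
    have h := hind.indepFun_finset {i} S (by simpa using hi) hX
    exact h.comp (φ := fun v : ({i} : Finset ℕ) → E => v ⟨i, by simp⟩) (ψ := id)
      (measurable_pi_apply _) measurable_id
  have hjoint := (indepFun_iff_map_prod_eq_prod_map_map (hX i).aemeasurable hT.aemeasurable).1 hXT
  have : IsProbabilityMeasure (P.map T) := Measure.isProbabilityMeasure_map hT.aemeasurable
  have e1 : {ω | s ≤ ∑ j ∈ S, (φ (X i ω) (X j ω) - ∫ y, φ (X i ω) y ∂ν)}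
      = (fun ω => (X i ω, T ω)) ⁻¹' W := by
    ext ω
    simp only [W, T, mem_preimage, mem_ofPred_eq]
    rw [Finset.sum_coe_sort S (fun j => φ (X i ω) (X j ω) - ∫ y, φ (X i ω) y ∂ν)]
  rw [e1, ← Measure.map_apply ((hX i).prodMk hT) hW, hjoint, hmap, Measure.prod_apply hW]
  calc _ ≤ ∫⁻ _, ENNReal.ofReal (Real.exp (-c * s + S.card * (c ^ 2 * V))) ∂ν := by
        refine lintegral_mono fun x => ?_
        rw [Measure.map_apply hT (measurable_prodMk_left hW)]
        refine le_trans (le_of_eq ?_) (measure_sum_sub_integral_ge_le hX hmap hind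
          (hφ.of_uncurry_left (x := x)) (hB x) (hV x) hc hcB S s)
        congr 1
        ext ω
        simp only [W, T, mem_preimage, mem_ofPred_eq]
        rw [Finset.sum_coe_sort S (fun j => φ x (X j ω) - ∫ y, φ x y ∂ν)]
    _ = _ := by simp

/-- Independent samples hit every set of positive probability. -/
lemma ae_exists_mem_of_measure_ne_zero {Ω E : Type*} [MeasurableSpace Ω] [MeasurableSpace E]
    {P : Measure Ω} [IsProbabilityMeasure P] {ν : Measure E} [IsProbabilityMeasure ν]
    {X : ℕ → Ω → E} (hX : ∀ i, Measurable (X i)) (hmap : ∀ i, P.map (X i) = ν)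
    (hind : iIndepFun X P) {V : Set E} (hV : MeasurableSet V) (hν : ν V ≠ 0) :
    ∀ᵐ ω ∂P, ∃ i, X i ω ∈ V := by
  have hlt : ν Vᶜ < 1 := by
    rw [prob_compl_eq_one_sub hV]
    exact ENNReal.sub_lt_self ENNReal.one_ne_top one_ne_zero hν
  have hle : ∀ n : ℕ, P {ω | ¬ ∃ i, X i ω ∈ V} ≤ ν Vᶜ ^ n := fun n => by
    calc _ ≤ P (⋂ i ∈ Finset.range n, X i ⁻¹' Vᶜ) := by
          refine measure_mono fun ω hω => ?_
          simp only [mem_ofPred_eq, not_exists] at hω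
          simp [hω]
      _ = ∏ i ∈ Finset.range n, P (X i ⁻¹' Vᶜ) :=
          hind.measure_inter_preimage_eq_mul _ fun _ _ => hV.compl
      _ = _ := by
          simp_rw [← Measure.map_apply (hX _) hV.compl, hmap]
          simp
  exact le_antisymm (ge_of_tendsto' (ENNReal.tendsto_pow_atTop_nhds_zero_of_lt_one hlt) hle)
    zero_le


/-! ### Geometry of the density near the levels -/

/-- Uniform gradient ascent near the levels in `[l, u]`, and uniform continuity there. -/
lemma RegularLevels.exists_band {d p : ℕ} (hp : 1 ≤ p) {f : Space d → ℝ} {l u : ℝ}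
    (hA : RegularLevels f p l u) :
    ∃ (ζ : ℝ) (C : Set (Space d)), 0 < ζ ∧ IsCompact C ∧ (∀ x ∈ C, ContinuousAt f x) ∧
      (∀ x ∉ C, f x < u + ζ → f x < l - ζ) ∧
      (∀ x ∉ C, l - ζ ≤ f x → ∀ᶠ y in nhds x, u + ζ ≤ f y) ∧
      ∀ ε > 0, ∃ c > 0, ∀ x ∈ C, ∃ y, dist x y ≤ ε ∧ f x + c ≤ f y ∧ ContinuousAt f y := by
  obtain ⟨ζ, U, m, k, hζ, hU, hUb, -, hCU, hsm, hm, hgrad, hlip⟩ := hA.smooth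
  set C := closure (levelSet f (l - ζ)) \ interior (levelSet f (u + ζ)) with hC
  have hdiff : ∀ x ∈ U, DifferentiableAt ℝ f x := fun x hx =>
    (hsm.differentiableOn (by exact_mod_cast (by omega : p ≠ 0))).differentiableAt
      (hU.mem_nhds hx)
  have hCc : IsCompact C := Metric.isCompact_of_isClosed_isBounded
    (isClosed_closure.sdiff isOpen_interior) (hUb.subset hCU)
  have hout : ∀ x ∉ C, l - ζ ≤ f x → ∀ᶠ y in nhds x, u + ζ ≤ f y := fun x hx hfx => by
    have : x ∈ interior (levelSet f (u + ζ)) := by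
      by_contra h
      exact hx ⟨subset_closure hfx, h⟩
    exact mem_interior_iff_mem_nhds.1 this
  refine ⟨ζ, C, hζ, hCc, fun x hx => (hdiff x (hCU hx)).continuousAt, fun x hx hfx => ?_, hout,
    fun ε hε => ?_⟩
  · by_contra! h
    exact absurd (hout x hx h).self_of_nhds (not_le.2 hfx)
  obtain ⟨ρ, hρ, hρU⟩ := hCc.exists_thickening_subset_open hU hCU
  -- The three bounds keep the endpoint within `ε`, the segment inside `U`, and the change of the
  -- gradient along it below `m / 2`; `|k| + 1` covers every sign of `k`.
  set η := min (min ε (ρ / 2)) (m / (2 * (|k| + 1))) with hη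
  have hη0 : 0 < η := by positivity
  have hkη : k * η ≤ m / 2 := by
    calc k * η ≤ (|k| + 1) * (m / (2 * (|k| + 1))) := by
          gcongr
          · linarith [le_abs_self k]
          · exact min_le_right _ _
      _ = m / 2 := by field_simp
  refine ⟨m / 2 * η, by positivity, fun x hx => ?_⟩
  have hxU := hCU hx
  have hg0 : 0 < ‖gradient f x‖ := hm.trans_le (hgrad x hxU)
  set v := ‖gradient f x‖⁻¹ • gradient f x with hv
  have hv1 : ‖v‖ = 1 := by
    rw [hv, norm_smul, norm_inv, norm_norm, inv_mul_cancel₀ hg0.ne']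
  have hseg : ∀ s ∈ Icc (0 : ℝ) η, x + s • v ∈ U := fun s hs => hρU <| by
    refine Metric.mem_thickening_iff.2 ⟨x, hx, ?_⟩
    rw [dist_eq_norm, add_sub_cancel_left, norm_smul, hv1, mul_one, Real.norm_eq_abs,
      abs_of_nonneg hs.1]
    have h1 : η ≤ ρ / 2 := (min_le_left _ _).trans (min_le_right _ _)
    linarith [hs.2]
  have hder : ∀ s ∈ Icc (0 : ℝ) η, HasDerivAt (fun s : ℝ => f (x + s • v))
      (inner ℝ (gradient f (x + s • v)) v) s := fun s hs => by
    have h1 := (hdiff _ (hseg s hs)).hasGradientAt.hasFDerivAt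
    have h2 : HasDerivAt (fun s : ℝ => x + s • v) v s := by
      simpa using ((hasDerivAt_id s).smul_const v).const_add x
    exact h1.comp_hasDerivAt s h2
  have hlow : ∀ s ∈ Icc (0 : ℝ) η, m / 2 ≤ inner ℝ (gradient f (x + s • v)) v := fun s hs => by
    have h1 : inner ℝ (gradient f x) v = ‖gradient f x‖ := by
      rw [hv, inner_smul_right, real_inner_self_eq_norm_sq]
      field_simp
    have h2 : inner ℝ (gradient f x - gradient f (x + s • v)) v ≤ k * ‖x - (x + s • v)‖ :=
      (real_inner_le_norm _ _).trans (by
        rw [hv1, mul_one]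
        exact hlip _ hxU _ (hseg s hs))
    have h3 : ‖x - (x + s • v)‖ = s := by
      rw [sub_add_cancel_left, norm_neg, norm_smul, hv1, mul_one, Real.norm_eq_abs,
        abs_of_nonneg hs.1]
    rw [inner_sub_left, h1, h3] at h2
    have h4 : k * s ≤ m / 2 := by
      rcases le_total 0 k with hk | hk
      · exact (mul_le_mul_of_nonneg_left hs.2 hk).trans hkη
      · exact (mul_nonpos_of_nonpos_of_nonneg hk hs.1).trans (by positivity)
    linarith [hgrad x hxU]
  have hη_mem : η ∈ Icc (0 : ℝ) η := ⟨hη0.le, le_rfl⟩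
  refine ⟨x + η • v, ?_, ?_, (hdiff _ (hseg η hη_mem)).continuousAt⟩
  · rw [dist_comm, dist_eq_norm, add_sub_cancel_left, norm_smul, hv1, mul_one, Real.norm_eq_abs,
      abs_of_nonneg hη0.le]
    exact (min_le_left _ _).trans (min_le_left _ _)
  · have := (convex_Icc (0 : ℝ) η).mul_sub_le_image_sub_of_le_deriv
      (f := fun s : ℝ => f (x + s • v))
      (fun s hs => (hder s hs).continuousAt.continuousWithinAt)
      (fun s hs => (hder s (interior_subset hs)).differentiableAt.differentiableWithinAt)
      (C := m / 2) (fun s hs => by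
        rw [(hder s (interior_subset hs)).deriv]; exact hlow s (interior_subset hs))
      0 ⟨le_rfl, hη0.le⟩ η hη_mem hη0.le
    simp only [zero_smul, add_zero, sub_zero] at this
    linarith

/-- A density with regular levels that is uniformly continuous below the level `l` is uniformly
continuous below the level `u`. -/
lemma RegularLevels.uniformContinuousOn {d p : ℕ} (hp : 1 ≤ p) {f : Space d → ℝ} {l u : ℝ}
    (hA : RegularLevels f p l u) (hf : UniformContinuousOn f (levelSet f l)ᶜ) :
    UniformContinuousOn f (levelSet f u)ᶜ := by
  obtain ⟨ζ, C, hζ, hC, hcont, hlow, -, -⟩ := hA.exists_band hp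
  rw [Metric.uniformContinuousOn_iff] at hf ⊢
  intro ε hε
  obtain ⟨r₁, hr₁, h₁⟩ := hf ε hε
  obtain ⟨r₂, hr₂, h₂⟩ := Metric.mem_uniformity_dist.1
    (hC.uniformContinuousAt_of_continuousAt f hcont (Metric.dist_mem_uniformity hε))
  refine ⟨min r₁ r₂, lt_min hr₁ hr₂, fun x hx y hy hxy => ?_⟩
  simp only [levelSet, mem_compl_iff, mem_ofPred_eq, not_le] at hx hy h₁
  by_cases hxC : x ∈ C
  · exact h₂ (hxy.trans_le (min_le_right _ _)) hxC
  by_cases hyC : y ∈ C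
  · rw [dist_comm]
    rw [dist_comm] at hxy
    exact h₂ (hxy.trans_le (min_le_right _ _)) hyC
  -- Off `C`, values below `u + ζ` are already below `l - ζ`, so both points lie below level `l`.
  · have := hlow x hxC (by linarith)
    have := hlow y hyC (by linarith)
    exact h₁ x (by linarith) y (by linarith) (hxy.trans_le (min_le_left _ _))

/-- Points at distance more than `ε` from `G(t)` are uniformly below the level `t`. -/
lemma RegularLevels.exists_forall_le_sub {d p : ℕ} (hp : 1 ≤ p) {f : Space d → ℝ} {l u : ℝ}
    (hA : RegularLevels f p l u) {ε : ℝ} (hε : 0 < ε) :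
    ∃ c > 0, ∀ t ∈ Icc l u, ∀ x, (∀ y, dist x y ≤ ε → f y < t) → f x ≤ t - c := by
  obtain ⟨ζ, C, hζ, hC, hcont, hlow, -, hasc⟩ := hA.exists_band hp
  obtain ⟨c, hc, h⟩ := hasc ε hε
  refine ⟨min c ζ, lt_min hc hζ, fun t ht x hx => ?_⟩
  -- On `C` an ascent of length at most `ε` gains `c` and still ends below `t`; off `C`, a value
  -- below `t ≤ u` drops below `l - ζ`.
  by_cases hxC : x ∈ C
  · obtain ⟨y, hy, hxy, -⟩ := h x hxC
    linarith [hx y hy, min_le_left c ζ]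
  · have := hx x (by simpa using hε.le)
    linarith [hlow x hxC (by linarith [ht.2]), min_le_right c ζ, ht.1]

/-- Near every point of `G(s)` there is an open set on which `f` is uniformly above `s`. -/
lemma RegularLevels.exists_forall_eventually {d p : ℕ} (hp : 1 ≤ p) {f : Space d → ℝ} {l u : ℝ}
    (hA : RegularLevels f p l u) {ε : ℝ} (hε : 0 < ε) :
    ∃ c > 0, ∀ s ∈ Icc l u, ∀ x, s ≤ f x →
      ∃ y, dist x y ≤ ε ∧ ∀ᶠ z in nhds y, s + c < f z := by
  obtain ⟨ζ, C, hζ, hC, hcont, -, hhigh, hasc⟩ := hA.exists_band hp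
  obtain ⟨c, hc, h⟩ := hasc ε hε
  -- Halving turns the gains `c` and `ζ` into strict inequalities, which persist on a neighbourhood.
  refine ⟨min c ζ / 2, by positivity, fun s hs x hx => ?_⟩
  have hcζ : 0 < min c ζ := lt_min hc hζ
  by_cases hxC : x ∈ C
  · obtain ⟨y, hy, hxy, hcy⟩ := h x hxC
    exact ⟨y, hy, hcy.eventually_const_lt (by linarith [min_le_left c ζ])⟩
  · refine ⟨x, by simpa using hε.le, ?_⟩
    filter_upwards [hhigh x hxC (by linarith [hs.1])] with z hz
    linarith [min_le_right c ζ, hs.2]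


/-! ### The density law and the mean of the estimator -/

lemma IsDensity.isProbabilityMeasure {d : ℕ} {f : Space d → ℝ} (hf : IsDensity f) :
    IsProbabilityMeasure (densityLaw f) :=
  ⟨by rw [densityLaw, withDensity_apply _ .univ, Measure.restrict_univ, hf.lintegral_eq_one]⟩

lemma IsDensity.integrable {d : ℕ} {f : Space d → ℝ} (hf : IsDensity f) :
    Integrable f :=
  (lintegral_ofReal_ne_top_iff_integrable hf.measurable.aestronglyMeasurable
    (.of_forall hf.nonneg)).1 (by simp [hf.lintegral_eq_one])

lemma IsDensity.integral_densityLaw {d : ℕ} {f : Space d → ℝ} (hf : IsDensity f)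
    (g : Space d → ℝ) : ∫ y, g y ∂(densityLaw f) = ∫ y, g y * f y := by
  rw [densityLaw, integral_withDensity_eq_integral_toReal_smul
    hf.measurable.ennreal_ofReal (.of_forall fun _ => ENNReal.ofReal_lt_top)]
  refine integral_congr_ae (.of_forall fun y => ?_)
  simp [hf.nonneg, mul_comm]

lemma IsDensity.densityLaw_ne_zero {d : ℕ} {f : Space d → ℝ} (hf : IsDensity f)
    {V : Set (Space d)} (hV : IsOpen V) (hne : V.Nonempty) (hpos : ∀ x ∈ V, 0 < f x) :
    densityLaw f V ≠ 0 := by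
  rw [densityLaw, withDensity_apply _ hV.measurableSet, Ne,
    setLIntegral_eq_zero_iff hV.measurableSet hf.measurable.ennreal_ofReal]
  intro h
  refine hV.measure_ne_zero volume hne (measure_mono_null (fun x hx => ?_) (ae_iff.1 h))
  simp only [mem_ofPred_eq, Classical.not_imp, ENNReal.ofReal_eq_zero, not_le]
  exact ⟨hx, hpos x hx⟩

/-- The mean of the kernel density estimator at `x`. -/
noncomputable def smoothed {d : ℕ} (K f : Space d → ℝ) (h : ℝ) (x : Space d) : ℝ :=
  ∫ y, (h ^ d)⁻¹ * K (h⁻¹ • (x - y)) * f y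

lemma integral_comp_inv_smul_sub {d : ℕ} (K : Space d → ℝ) {h : ℝ} (hh : 0 < h) (x : Space d) :
    ∫ y, K (h⁻¹ • (x - y)) = h ^ d * ∫ z, K z := by
  rw [integral_sub_left_eq_self (fun y => K (h⁻¹ • y)) volume x,
    Measure.integral_comp_inv_smul volume K h]
  simp [abs_of_pos hh]

lemma integral_rescaled {d : ℕ} (K : Space d → ℝ) {h : ℝ} (hh : 0 < h) (x : Space d) :
    ∫ y, (h ^ d)⁻¹ * K (h⁻¹ • (x - y)) = ∫ z, K z := by
  rw [integral_const_mul, integral_comp_inv_smul_sub K hh, inv_mul_cancel_left₀ (by positivity)]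

lemma integrable_rescaled {d : ℕ} {K : Space d → ℝ} (hK : Integrable K) {h : ℝ} (hh : 0 < h)
    (x : Space d) : Integrable fun y => (h ^ d)⁻¹ * K (h⁻¹ • (x - y)) :=
  (((hK.comp_smul (inv_ne_zero hh.ne')).comp_sub_left x)).const_mul _

lemma IsDensity.integral_comp_inv_smul_sub {d : ℕ} {f : Space d → ℝ} (hf : IsDensity f)
    (K : Space d → ℝ) {h : ℝ} (hh : 0 < h) (x : Space d) :
    ∫ y, K (h⁻¹ • (x - y)) ∂(densityLaw f) = h ^ d * smoothed K f h x := by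
  rw [hf.integral_densityLaw, smoothed, ← integral_const_mul]
  congr 1 with y
  have : h ^ d ≠ 0 := by positivity
  field_simp

/-- The change of variables supplies the factor `h^d` that makes the Bernstein exponent proportional
to `n h^d`. -/
lemma IsDensity.integral_sq_comp_inv_smul_sub_le {d : ℕ} {f : Space d → ℝ} (hf : IsDensity f)
    {F : ℝ} (hF : ∀ x, f x ≤ F) {K : Space d → ℝ} (hK : Integrable fun z => K z ^ 2) {h : ℝ}
    (hh : 0 < h) (x : Space d) :
    ∫ y, K (h⁻¹ • (x - y)) ^ 2 ∂(densityLaw f) ≤ (F * ∫ z, K z ^ 2) * h ^ d := by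
  have hi : Integrable fun y => K (h⁻¹ • (x - y)) ^ 2 :=
    (hK.comp_smul (inv_ne_zero hh.ne')).comp_sub_left x
  rw [hf.integral_densityLaw]
  calc _ ≤ ∫ y, K (h⁻¹ • (x - y)) ^ 2 * F :=
        integral_mono_of_nonneg (.of_forall fun y => mul_nonneg (sq_nonneg _) (hf.nonneg y))
          (hi.mul_const F) (.of_forall fun y => mul_le_mul_of_nonneg_left (hF y) (sq_nonneg _))
    _ = _ := by
        rw [integral_mul_const, LevelSetEstimation.integral_comp_inv_smul_sub (fun z => K z ^ 2) hh]
        ring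

lemma norm_inv_smul_sub_gt {d : ℕ} {R h : ℝ} (hh : 0 < h) {x y : Space d}
    (hxy : R * h < dist x y) : R < ‖h⁻¹ • (x - y)‖ := by
  rw [norm_smul, norm_inv, Real.norm_eq_abs, abs_of_pos hh, ← dist_eq_norm,
    lt_inv_mul_iff₀ hh, mul_comm]
  exact hxy

section Smoothed

variable {d : ℕ} {K f : Space d → ℝ} {R B h : ℝ}

lemma integrable_rescaled_mul (hK : Continuous K) (hB : ∀ z, |K z| ≤ B) (hf : Integrable f)
    (x : Space d) : Integrable fun y => (h ^ d)⁻¹ * K (h⁻¹ • (x - y)) * f y := by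
  refine hf.bdd_mul (c := |(h ^ d)⁻¹| * B) (by fun_prop) (.of_forall fun y => ?_)
  rw [norm_mul, Real.norm_eq_abs, Real.norm_eq_abs]
  gcongr
  exact hB _

/-- The rescaled kernel has mass one, so a constant can be moved inside the integral. -/
lemma smoothed_sub (hK : Continuous K) (hKi : Integrable K) (hK1 : ∫ z, K z = 1)
    (hB : ∀ z, |K z| ≤ B) (hf : Integrable f) (hh : 0 < h) (x : Space d) (a : ℝ) :
    smoothed K f h x - a = ∫ y, (h ^ d)⁻¹ * K (h⁻¹ • (x - y)) * (f y - a) := by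
  have h1 : a = ∫ y, (h ^ d)⁻¹ * K (h⁻¹ • (x - y)) * a := by
    rw [integral_mul_const, integral_rescaled K hh, hK1, one_mul]
  conv_lhs => rw [h1]
  rw [smoothed, ← integral_sub (integrable_rescaled_mul hK hB hf x)
    ((integrable_rescaled hKi hh x).mul_const a)]
  congr 1 with y
  ring

lemma abs_smoothed_sub_le (hK : Continuous K) (hKi : Integrable K) (hK1 : ∫ z, K z = 1)
    (hB : ∀ z, |K z| ≤ B) (hR : ∀ z, R < ‖z‖ → K z = 0) (hf : Integrable f) (hh : 0 < h)
    {x : Space d} {a c : ℝ} (hc : ∀ y, dist x y ≤ R * h → |f y - a| ≤ c) :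
    |smoothed K f h x - a| ≤ c * ∫ z, |K z| := by
  have hi := (integrable_rescaled hKi.abs hh x).const_mul c
  rw [smoothed_sub hK hKi hK1 hB hf hh, ← integral_rescaled (fun z => |K z|) hh x,
    ← integral_const_mul, ← Real.norm_eq_abs]
  refine norm_integral_le_of_norm_le hi (.of_forall fun y => ?_)
  rw [Real.norm_eq_abs, abs_mul, abs_mul, abs_of_pos (by positivity : 0 < (h ^ d)⁻¹)]
  rcases le_or_gt (dist x y) (R * h) with hxy | hxy
  · rw [mul_comm c]
    gcongr
    exact hc y hxy
  · simp [hR _ (norm_inv_smul_sub_gt hh hxy)]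

lemma smoothed_le (hK : Continuous K) (hKi : Integrable K) (hK1 : ∫ z, K z = 1)
    (hK0 : ∀ z, 0 ≤ K z)
    (hB : ∀ z, |K z| ≤ B) (hR : ∀ z, R < ‖z‖ → K z = 0) (hf : Integrable f) (hh : 0 < h)
    {x : Space d} {a : ℝ} (hc : ∀ y, dist x y ≤ R * h → f y ≤ a) :
    smoothed K f h x ≤ a := by
  rw [← sub_nonpos, smoothed_sub hK hKi hK1 hB hf hh]
  refine integral_nonpos fun y => ?_
  rcases le_or_gt (dist x y) (R * h) with hxy | hxy
  · exact mul_nonpos_of_nonneg_of_nonpos (mul_nonneg (by positivity) (hK0 _))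
      (sub_nonpos.2 (hc y hxy))
  · simp [hR _ (norm_inv_smul_sub_gt hh hxy)]

/-- The rescaled kernel is at most `B h^{-d}` and lives on a ball of radius `R h`, so the error is
at most `B v` times the mean of `|f - f x|` over that ball; this tends to zero at Lebesgue points.
-/
lemma ae_tendsto_smoothed (hK : Continuous K) (hKi : Integrable K) (hK1 : ∫ z, K z = 1)
    (hB : ∀ z, |K z| ≤ B) (hR0 : 0 < R) (hR : ∀ z, R < ‖z‖ → K z = 0) (hf : Integrable f)
    {b : ℕ → ℝ} (hb : Tendsto b atTop (nhds 0)) (hb0 : ∀ᶠ n in atTop, 0 < b n) :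
    ∀ᵐ x, Tendsto (fun n => smoothed K f (b n) x) atTop (nhds (f x)) := by
  filter_upwards [IsUnifLocDoublingMeasure.ae_tendsto_average_norm_sub (volume : Measure (Space d))
    hf.locallyIntegrable 1] with x hx
  have hδ : Tendsto (fun n => R * b n) atTop (nhdsWithin 0 (Ioi 0)) := by
    refine tendsto_nhdsWithin_iff.2 ⟨by simpa using hb.const_mul R, ?_⟩
    filter_upwards [hb0] with n hn using mul_pos hR0 hn
  have hav := hx (fun _ => x) _ hδ (by
    filter_upwards [hb0] with n hn
    simpa using (mul_pos hR0 hn).le)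
  rw [tendsto_iff_norm_sub_tendsto_zero]
  set v := volume.real (Metric.closedBall (0 : Space d) R) with hv
  have hav' := hav.const_mul (B * v)
  rw [mul_zero] at hav'
  refine squeeze_zero' (.of_forall fun n => norm_nonneg _) ?_ hav'
  filter_upwards [hb0] with n hn
  have hvol : volume.real (Metric.closedBall x (R * b n)) = b n ^ d * v := by
    rw [hv, Measure.real, Measure.addHaar_closedBall' volume _ (mul_pos hR0 hn).le,
      Measure.real, Measure.addHaar_closedBall' volume _ hR0.le, ENNReal.toReal_mul,
      ENNReal.toReal_mul, ENNReal.toReal_ofReal (by positivity),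
      ENNReal.toReal_ofReal (by positivity)]
    simp only [finrank_euclideanSpace, Fintype.card_fin]
    ring
  have hv0 : v ≠ 0 := (ENNReal.toReal_pos
    (Metric.measure_closedBall_pos volume _ hR0).ne' measure_closedBall_lt_top.ne).ne'
  rw [smoothed_sub hK hKi hK1 hB hf hn, setAverage_eq, hvol, smul_eq_mul,
    ← integral_indicator Metric.isClosed_closedBall.measurableSet, ← integral_const_mul,
    ← integral_const_mul]
  refine norm_integral_le_of_norm_le ?_ (.of_forall fun y => ?_)
  · refine ((IntegrableOn.integrable_indicator ?_
      Metric.isClosed_closedBall.measurableSet).const_mul _).const_mul _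
    exact (hf.integrableOn.sub (integrableOn_const measure_closedBall_lt_top.ne)).norm
  · have hbd : 0 < b n ^ d := by positivity
    rcases le_or_gt (dist x y) (R * b n) with hxy | hxy
    · rw [indicator_of_mem (by simpa [dist_comm] using hxy), norm_mul, norm_mul,
        Real.norm_of_nonneg (inv_nonneg.2 hbd.le), ← mul_assoc]
      refine mul_le_mul_of_nonneg_right ?_ (norm_nonneg _)
      rw [Real.norm_eq_abs]
      calc _ ≤ (b n ^ d)⁻¹ * B := by gcongr; exact hB _
        _ = _ := by field_simp
    · simp [hR _ (norm_inv_smul_sub_gt hn hxy), hxy, dist_comm]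

end Smoothed


/-! ### Asymptotics of the bandwidth and the threshold -/

lemma tendsto_log_div_self_rpow {e : ℝ} (he : 0 < e) :
    Tendsto (fun n : ℕ => (Real.log n / n) ^ e) atTop (nhds 0) := by
  have h1 : Tendsto (fun x : ℝ => Real.log x / x) atTop (nhds 0) :=
    Real.isLittleO_log_id_atTop.tendsto_div_nhds_zero
  have h2 := (h1.comp tendsto_natCast_atTop_atTop).rpow_const (p := e) (.inr he.le)
  simpa [Real.zero_rpow he.ne'] using h2

lemma tendsto_thresholdShift {d p : ℕ} (hp : 1 ≤ p) (M : ℝ) :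
    Tendsto (thresholdShift d p M) atTop (nhds 0) := by
  have hp' : (0 : ℝ) < p := by exact_mod_cast hp
  have := (tendsto_log_div_self_rpow (e := (p : ℝ) / (d + 2 * p)) (by positivity)).const_mul M
  rwa [mul_zero] at this

lemma thresholdShift_nonneg {d p : ℕ} {M : ℝ} (hM : 0 ≤ M) (n : ℕ) :
    0 ≤ thresholdShift d p M n :=
  mul_nonneg hM (Real.rpow_nonneg (div_nonneg (Real.log_natCast_nonneg n) n.cast_nonneg) _)

lemma IsAdmissibleBandwidth.tendsto_zero {d p : ℕ} (hp : 1 ≤ p) {h : ℕ → ℝ}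
    (hh : IsAdmissibleBandwidth d p h) : Tendsto h atTop (nhds 0) := by
  have hp' : (0 : ℝ) < p := by exact_mod_cast hp
  exact hh.2.isBigO.trans_tendsto (tendsto_log_div_self_rpow (by positivity))

lemma IsAdmissibleBandwidth.exists_rpow_le {d p : ℕ} (hp : 1 ≤ p) {h : ℕ → ℝ}
    (hh : IsAdmissibleBandwidth d p h) :
    ∃ a c : ℝ, 0 < a ∧ 0 < c ∧ ∀ᶠ n : ℕ in atTop, c * (n : ℝ) ^ a ≤ n * h n ^ d := by
  have hp' : (0 : ℝ) < p := by exact_mod_cast hp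
  set e : ℝ := 1 / ((d : ℝ) + 2 * p) with he
  have he0 : 0 < e := by positivity
  obtain ⟨C, hC, hCb⟩ := hh.2.isBigO_symm.exists_pos
  refine ⟨1 - e * d, (C⁻¹) ^ d, ?_, by positivity, ?_⟩
  · rw [he, sub_pos, div_mul_eq_mul_div, one_mul, div_lt_one (by positivity)]
    linarith
  -- From `n ≥ 3` on, `log n ≥ 1`, so the logarithm can be dropped from the lower bound for `h`.
  filter_upwards [hCb.bound, hh.1, eventually_ge_atTop 3] with n hn hpos hn3
  have hn0 : (0 : ℝ) < n := by positivity
  have hlog : 1 ≤ Real.log n := by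
    rw [Real.le_log_iff_exp_le hn0]
    have : (3 : ℝ) ≤ n := by exact_mod_cast hn3
    linarith [Real.exp_one_lt_d9]
  have h1 : (n : ℝ) ^ (-e) ≤ C * h n := by
    calc (n : ℝ) ^ (-e) = (1 / (n : ℝ)) ^ e := by
          rw [Real.rpow_neg hn0.le, one_div, Real.inv_rpow hn0.le]
      _ ≤ (Real.log n / n) ^ e := by gcongr
      _ ≤ C * h n := by
          refine (le_abs_self _).trans (hn.trans_eq ?_)
          rw [Real.norm_of_nonneg hpos.le]
  have h2 : C⁻¹ * (n : ℝ) ^ (-e) ≤ h n := by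
    rwa [inv_mul_le_iff₀ hC]
  calc (C⁻¹) ^ d * (n : ℝ) ^ (1 - e * d) = n * (C⁻¹ * (n : ℝ) ^ (-e)) ^ d := by
        rw [mul_pow, ← Real.rpow_natCast ((n : ℝ) ^ (-e)), ← Real.rpow_mul hn0.le,
          sub_eq_add_neg, Real.rpow_add hn0, Real.rpow_one, neg_mul]
        ring
    _ ≤ _ := by gcongr

lemma summable_mul_exp_neg_mul_rpow {a c : ℝ} (ha : 0 < a) (hc : 0 < c) :
    Summable fun n : ℕ => (n : ℝ) * Real.exp (-(c * (n : ℝ) ^ a)) := by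
  -- The exponent `-3 / a` yields `n^{-3}`, hence `n^{-2}` after the factor `n`.
  have h1 : (fun n : ℕ => Real.exp (-c * (n : ℝ) ^ a)) =o[atTop]
      fun n : ℕ => ((n : ℝ) ^ a) ^ (-3 / a) :=
    (isLittleO_exp_neg_mul_rpow_atTop hc (-3 / a)).comp_tendsto
      ((tendsto_rpow_atTop ha).comp tendsto_natCast_atTop_atTop)
  refine summable_of_isBigO_nat (g := fun n : ℕ => (n : ℝ) ^ (-2 : ℝ))
    (Real.summable_nat_rpow.2 (by norm_num)) ?_
  refine ((Asymptotics.isBigO_refl (fun n : ℕ => (n : ℝ)) atTop).mul h1.isBigO).congr' ?_ ?_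
  · exact .of_forall fun n => by simp
  · filter_upwards [eventually_gt_atTop 0] with n hn
    have hn0 : (0 : ℝ) < n := by exact_mod_cast hn
    rw [← Real.rpow_mul hn0.le, mul_div_cancel₀ _ ha.ne', ← Real.rpow_one_add' hn0.le (by norm_num)]
    norm_num

/-! ### Concentration of the estimator at the sample points -/

section Concentration

variable {d p : ℕ} {f K : Space d → ℝ} {B δ : ℝ} {h : ℕ → ℝ} {Ω : Type*} [MeasurableSpace Ω]
  {P : Measure Ω} [IsProbabilityMeasure P] {X : ℕ → Ω → Space d}

lemma ae_eventually_kernelEstimator_sub_smoothed_lt (hp : 1 ≤ p) (hf : IsDensity f)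
    (hfb : BddAbove (range f)) (hK : Continuous K) (hK2 : Integrable fun z => K z ^ 2)
    (hB : ∀ z, |K z| ≤ B) (hh : IsAdmissibleBandwidth d p h) (hX : ∀ i, Measurable (X i))
    (hmap : ∀ i, P.map (X i) = densityLaw f) (hind : iIndepFun X P) (hδ : 0 < δ) :
    ∀ᵐ ω ∂P, ∀ᶠ n in atTop, ∀ i < n,
      kernelEstimator K (h n) n (fun i => X i ω) (X i ω) - smoothed K f (h n) (X i ω) < δ := by
  have := hf.isProbabilityMeasure
  have hB0 : 0 ≤ B := (abs_nonneg _).trans (hB 0)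
  obtain ⟨F, hF⟩ := hfb
  replace hF : ∀ x, f x ≤ F := fun x => hF (mem_range_self x)
  have hF0 : 0 ≤ F := (hf.nonneg 0).trans (hF 0)
  obtain ⟨a, c₀, ha, hc₀, hrate⟩ := hh.exists_rpow_le hp
  set V := F * ∫ z, K z ^ 2 with hV
  have hV0 : 0 ≤ V := mul_nonneg hF0 (integral_nonneg fun z => sq_nonneg _)
  -- The first bound permits Bernstein's inequality; the second makes the variance term at most half
  -- of the linear term `c δ / 2`.
  set c := min (1 / (B + 1)) (δ / (4 * (V + 1))) with hc
  have hc0 : 0 < c := by positivity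
  have hcB : c * B ≤ 1 := by
    calc c * B ≤ 1 / (B + 1) * (B + 1) := by gcongr; exacts [min_le_left _ _, by linarith]
      _ = 1 := by field_simp
  have hcV : c * V ≤ δ / 4 := by
    calc c * V ≤ δ / (4 * (V + 1)) * (V + 1) := by gcongr; exacts [min_le_right _ _, by linarith]
      _ = _ := by field_simp
  let φ : ℕ → Space d → Space d → ℝ := fun n x y => K ((h n)⁻¹ • (x - y))
  -- The `i`-th term is removed for independence. The threshold is `δ / 2`; the other half later
  -- absorbs the term `K 0` and the one missing mean, together at most `2 B`.
  let bad : ℕ → ℕ → Set Ω := fun n i => {ω | δ / 2 * (n * h n ^ d) ≤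
    ∑ j ∈ (Finset.range n).erase i,
      (φ n (X i ω) (X j ω) - ∫ y, φ n (X i ω) y ∂(densityLaw f))}
  have hbad : ∀ᶠ n in atTop, ∀ i < n,
      P (bad n i) ≤ ENNReal.ofReal (Real.exp (-(c * δ / 4 * c₀ * (n : ℝ) ^ a))) := by
    filter_upwards [hrate, hh.1] with n hn hpos i hi
    refine (measure_sum_sub_integral_sample_ge_le (V := V * h n ^ d) (B := B) (c := c) hX hmap hind
      (φ := φ n) ?_ (fun x y => hB _)
      (fun x => hf.integral_sq_comp_inv_smul_sub_le hF hK2 hpos x) hc0.le hcB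
      (Finset.notMem_erase i _) _).trans ?_
    · exact (hK.comp (by fun_prop : Continuous fun q : Space d × Space d =>
        (h n)⁻¹ • (q.1 - q.2))).measurable
    refine ENNReal.ofReal_le_ofReal (Real.exp_le_exp.2 ?_)
    have h1 : (((Finset.range n).erase i).card : ℝ) ≤ n := by
      exact_mod_cast (Finset.card_erase_le).trans_eq (Finset.card_range n)
    have hnh : 0 ≤ n * h n ^ d := by positivity
    calc -c * (δ / 2 * (n * h n ^ d)) + (((Finset.range n).erase i).card : ℝ)
            * (c ^ 2 * (V * h n ^ d))
          ≤ -c * (δ / 2 * (n * h n ^ d)) + n * (c ^ 2 * (V * h n ^ d)) := by gcongr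
      _ = -(c * δ / 2) * (n * h n ^ d) + c * (n * h n ^ d) * (c * V) := by ring
      _ ≤ -(c * δ / 2) * (n * h n ^ d) + c * (n * h n ^ d) * (δ / 4) := by gcongr
      _ = -(c * δ / 4 * (n * h n ^ d)) := by ring
      _ ≤ -(c * δ / 4 * (c₀ * (n : ℝ) ^ a)) := by gcongr
      _ = _ := by ring
  have hsum : ∑' n, P (⋃ i ∈ Finset.range n, bad n i) ≠ ⊤ := by
    have hs : Summable fun n => P.real (⋃ i ∈ Finset.range n, bad n i) := by
      refine Summable.of_norm_bounded_eventually_nat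
        (summable_mul_exp_neg_mul_rpow ha (by positivity : 0 < c * δ / 4 * c₀)) ?_
      filter_upwards [hbad] with n hn
      rw [Real.norm_of_nonneg measureReal_nonneg]
      refine (measureReal_biUnion_finset_le _ _).trans ?_
      rw [← nsmul_eq_mul]
      refine (Finset.sum_le_card_nsmul _ _ _ fun i hi => ?_).trans_eq (by rw [Finset.card_range])
      exact ENNReal.toReal_le_of_le_ofReal (Real.exp_pos _).le (hn i (Finset.mem_range.1 hi))
    simpa [Measure.real] using hs.tsum_ofReal_ne_top
  have hlarge : ∀ᶠ n : ℕ in atTop, 2 * B < δ / 2 * (n * h n ^ d) := by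
    have ht : Tendsto (fun n : ℕ => c₀ * (n : ℝ) ^ a) atTop atTop :=
      ((tendsto_rpow_atTop ha).comp tendsto_natCast_atTop_atTop).const_mul_atTop hc₀
    filter_upwards [hrate, ht.eventually_gt_atTop (2 * B / (δ / 2))] with n hn hn2
    rw [div_lt_iff₀' (by positivity)] at hn2
    exact hn2.trans_le (by gcongr)
  filter_upwards [ae_eventually_notMem hsum] with ω hω
  filter_upwards [hω, hlarge, hh.1] with n hn hl hpos i hi
  have hni : ω ∉ bad n i := fun hmem =>
    hn (mem_biUnion (Finset.mem_coe.2 (Finset.mem_range.2 hi)) hmem)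
  simp only [bad, φ, mem_ofPred_eq, not_le, Finset.sum_sub_distrib, Finset.sum_const,
    nsmul_eq_mul, Finset.card_erase_of_mem (Finset.mem_range.2 hi), Finset.card_range,
    hf.integral_comp_inv_smul_sub K hpos] at hni
  have hn0 : (0 : ℝ) < n := by exact_mod_cast (Nat.zero_le i).trans_lt hi
  rw [Nat.cast_sub (by omega), Nat.cast_one] at hni
  have hsm : |h n ^ d * smoothed K f (h n) (X i ω)| ≤ B := by
    rw [← hf.integral_comp_inv_smul_sub K hpos, ← Real.norm_eq_abs]
    exact (norm_integral_le_of_norm_le_const (.of_forall fun y => hB _)).trans_eq (by simp)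
  have hK0 := (abs_le.1 (hB ((h n)⁻¹ • (X i ω - X i ω)))).2
  have hnh : 0 < n * h n ^ d := by positivity
  rw [sub_lt_iff_lt_add, kernelEstimator, inv_mul_lt_iff₀ hnh,
    ← Finset.add_sum_erase _ _ (Finset.mem_range.2 hi)]
  nlinarith [(abs_le.1 hsm).1]

/-- The lower tail is the upper tail for the kernel `-K`. -/
lemma ae_eventually_abs_kernelEstimator_sub_smoothed_lt (hp : 1 ≤ p) (hf : IsDensity f)
    (hfb : BddAbove (range f)) (hK : Continuous K) (hK2 : Integrable fun z => K z ^ 2)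
    (hB : ∀ z, |K z| ≤ B) (hh : IsAdmissibleBandwidth d p h) (hX : ∀ i, Measurable (X i))
    (hmap : ∀ i, P.map (X i) = densityLaw f) (hind : iIndepFun X P) (hδ : 0 < δ) :
    ∀ᵐ ω ∂P, ∀ᶠ n in atTop, ∀ i < n,
      |kernelEstimator K (h n) n (fun i => X i ω) (X i ω) - smoothed K f (h n) (X i ω)| < δ := by
  filter_upwards [ae_eventually_kernelEstimator_sub_smoothed_lt hp hf hfb hK hK2 hB hh hX hmap
      hind hδ, ae_eventually_kernelEstimator_sub_smoothed_lt hp hf hfb (K := fun z => -K z) hK.neg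
      (by simpa using hK2) (by simpa using hB) hh hX hmap hind hδ] with ω h1 h2
  filter_upwards [h1, h2] with n h1 h2 i hi
  have h3 := h2 i hi
  simp only [kernelEstimator, smoothed, Finset.sum_neg_distrib, mul_neg, neg_mul,
    integral_neg] at h3
  refine abs_lt.2 ⟨?_, h1 i hi⟩
  simp only [kernelEstimator, smoothed]
  linarith

end Concentration


/-! ### From concentration to Hausdorff distance -/

/-- Independent samples from a density hit every nonempty open set where the density is positive. -/
lemma ae_forall_isOpen_exists_mem {d : ℕ} {f : Space d → ℝ} (hf : IsDensity f) {Ω : Type*}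
    [MeasurableSpace Ω] {P : Measure Ω} [IsProbabilityMeasure P] {X : ℕ → Ω → Space d}
    (hX : ∀ i, Measurable (X i)) (hmap : ∀ i, P.map (X i) = densityLaw f) (hind : iIndepFun X P) :
    ∀ᵐ ω ∂P, ∀ V : Set (Space d), IsOpen V → V.Nonempty → (∀ x ∈ V, 0 < f x) →
      ∃ i, X i ω ∈ V := by
  have := hf.isProbabilityMeasure
  have h : ∀ᵐ ω ∂P, ∀ V ∈ TopologicalSpace.countableBasis (Space d),
      V.Nonempty → (∀ x ∈ V, 0 < f x) → ∃ i, X i ω ∈ V := by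
    refine (ae_ball_iff (TopologicalSpace.countable_countableBasis _)).2 fun V hV => ?_
    by_cases hc : V.Nonempty ∧ ∀ x ∈ V, 0 < f x
    · have hVo := TopologicalSpace.isOpen_of_mem_countableBasis hV
      filter_upwards [ae_exists_mem_of_measure_ne_zero hX hmap hind hVo.measurableSet
        (hf.densityLaw_ne_zero hVo hc.1 hc.2)] with ω hω _ _ using hω
    · exact .of_forall fun ω h1 h2 => absurd ⟨h1, h2⟩ hc
  filter_upwards [h] with ω hω V hV ⟨x, hx⟩ hpos
  obtain ⟨W, hW, hxW, hWV⟩ :=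
    (TopologicalSpace.isBasis_countableBasis (Space d)).exists_subset_of_mem_open hx hV
  obtain ⟨i, hi⟩ := hω W hW ⟨x, hxW⟩ fun y hy => hpos y (hWV hy)
  exact ⟨i, hWV hi⟩

section Deterministic

variable {d p : ℕ} {f K : Space d → ℝ} {l u B R ε : ℝ} {b : ℕ → ℝ}

/-- Away from `G(t)`, the mean of the estimator is eventually below the level `t`. -/
lemma eventually_smoothed_add_le (hp : 1 ≤ p) (hf : Integrable f) (hA : RegularLevels f p l u)
    (hK : Continuous K) (hKi : Integrable K) (hK1 : ∫ z, K z = 1) (hB : ∀ z, |K z| ≤ B)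
    (hR : ∀ z, R < ‖z‖ → K z = 0)
    (hKf : (∀ z, 0 ≤ K z) ∨ UniformContinuousOn f (levelSet f l)ᶜ)
    (hb : Tendsto b atTop (nhds 0)) (hb0 : ∀ᶠ n in atTop, 0 < b n) (hε : 0 < ε) :
    ∃ δ > 0, ∀ᶠ n in atTop, ∀ t ∈ Icc l u, ∀ x, (∀ y, dist x y ≤ ε → f y < t) →
      smoothed K f (b n) x + δ ≤ t := by
  -- With `ε / 2`, the margin `c` holds at every point within `ε / 2` of `x`, which contains the
  -- reach `R h` of the kernel.
  obtain ⟨c, hc, hlow⟩ := hA.exists_forall_le_sub hp (half_pos hε)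
  have hsmall : ∀ r > 0, ∀ᶠ n in atTop, R * b n < r := fun r hr =>
    (by simpa using hb.const_mul R : Tendsto (fun n => R * b n) atTop (nhds 0)).eventually_lt_const
      hr
  rcases hKf with hK0 | huc
  · refine ⟨c, hc, ?_⟩
    filter_upwards [hb0, hsmall _ (half_pos hε)] with n hn hn2 t ht x hx
    rw [← le_sub_iff_add_le]
    refine smoothed_le hK hKi hK1 hK0 hB hR hf hn fun y hy => hlow t ht y fun z hz => hx z ?_
    linarith [dist_triangle x y z]
  -- A signed kernel does not preserve one-sided bounds; uniform continuity keeps the mean within `c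
  -- / 2` of `f x`.
  · set I := ∫ z, |K z| with hI
    have hI0 : 0 ≤ I := integral_nonneg fun z => abs_nonneg _
    obtain ⟨r, hr, hruc⟩ := Metric.uniformContinuousOn_iff.1 (hA.uniformContinuousOn hp huc)
      (c / (2 * (I + 1))) (by positivity)
    refine ⟨c / 2, by positivity, ?_⟩
    filter_upwards [hb0, hsmall _ hε, hsmall r hr] with n hn hn2 hn3 t ht x hx
    have hfx := hlow t ht x fun y hy => hx y (by linarith)
    have hbelow : ∀ y, dist x y ≤ ε → y ∈ (levelSet f u)ᶜ := fun y hy =>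
      not_le.2 ((hx y hy).trans_le ht.2)
    have h1 := abs_smoothed_sub_le hK hKi hK1 hB hR hf hn (x := x) (a := f x)
      (c := c / (2 * (I + 1))) fun y hy => by
        have := hruc y (hbelow y (by linarith)) x (hbelow x (by simpa using hε.le))
          (by rw [dist_comm]; linarith)
        exact this.le
    have h2 : c / (2 * (I + 1)) * I ≤ c / 2 := by
      calc _ ≤ c / (2 * (I + 1)) * (I + 1) := by gcongr; linarith
        _ = _ := by field_simp
    linarith [(abs_le.1 h1).2]

lemma eventually_exists_close_sample (hp : 1 ≤ p) (hA : RegularLevels f p l u) (hl : 0 < l)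
    (hbdd : Bornology.IsBounded (levelSet f l)) {pts : ℕ → Space d} {D : ℕ → ℝ}
    (hD : Tendsto D atTop (nhds 0))
    (hdense : ∀ V : Set (Space d), IsOpen V → V.Nonempty → (∀ x ∈ V, 0 < f x) → ∃ i, pts i ∈ V)
    (hleb : ∀ i, Tendsto (fun n => smoothed K f (b n) (pts i)) atTop (nhds (f (pts i))))
    (hconc : ∀ δ > 0, ∀ᶠ n in atTop, ∀ i < n,
      |kernelEstimator K (b n) n pts (pts i) - smoothed K f (b n) (pts i)| < δ) (hε : 0 < ε) :
    ∀ᶠ n in atTop, ∀ t ∈ Icc l u, ∀ x ∈ levelSet f t,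
      ∃ y ∈ plusSample K (b n) (D n) n pts t, dist x y ≤ ε := by
  obtain ⟨c, hc, hup⟩ := hA.exists_forall_eventually hp (by positivity : 0 < ε / 3)
  set T : Set (Space d × ℝ) := {q | q.2 ∈ Icc l u ∧ q.2 ≤ f q.1} with hT
  have hTb : TotallyBounded T := by
    refine TotallyBounded.subset (s₂ := closure (levelSet f l) ×ˢ Icc l u) (fun q hq => ?_)
      ((Metric.isCompact_of_isClosed_isBounded isClosed_closure hbdd.closure).prod
        isCompact_Icc).totallyBounded
    exact ⟨subset_closure (hq.1.1.trans hq.2), hq.1⟩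
  -- The distance `ε` splits into thirds: to the net, ascent, to the sample point. Of the gain `c`,
  -- a quarter each pays for the change of level, the fluctuation and `D n`.
  obtain ⟨N, hNT, hNfin, hN⟩ := Metric.finite_approx_of_totallyBounded hTb (min (ε / 3) (c / 4))
    (by positivity)
  have hpt : ∀ q ∈ N, ∃ i, dist q.1 (pts i) ≤ 2 * ε / 3 ∧ q.2 + c < f (pts i) := fun q hq => by
    obtain ⟨y, hy, hev⟩ := hup q.2 (hNT hq).1 q.1 (hNT hq).2
    obtain ⟨V, hVsub, hVo, hyV⟩ := mem_nhds_iff.1 hev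
    obtain ⟨i, hiV, hiball⟩ := hdense (V ∩ Metric.ball y (ε / 3)) (hVo.inter Metric.isOpen_ball)
      -- Positivity of `l` makes `f` positive on this open set, so the sample visits it.
      ⟨y, hyV, Metric.mem_ball_self (by positivity)⟩ fun x hx => by
        have h1 : q.2 + c < f x := hVsub hx.1
        linarith [(hNT hq).1.1]
    refine ⟨i, ?_, hVsub hiV⟩
    rw [Metric.mem_ball, dist_comm] at hiball
    linarith [dist_triangle q.1 y (pts i)]
  choose! i hi hfi using hpt
  have hev : ∀ᶠ n in atTop, ∀ q ∈ N, i q < n ∧ q.2 + c < smoothed K f (b n) (pts (i q)) :=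
    (eventually_all_finite hNfin).2 fun q hq =>
      (eventually_gt_atTop _).and ((hleb (i q)).eventually_const_lt (hfi q hq))
  filter_upwards [hev, hconc (c / 4) (by positivity),
    hD.eventually_le_const (by positivity : 0 < c / 4)] with n hn hcn hDn t ht x hx
  obtain ⟨q, hq, hxq⟩ := mem_iUnion₂.1 (hN (show (x, t) ∈ T from ⟨ht, hx⟩))
  rw [Metric.mem_ball, Prod.dist_eq, max_lt_iff, lt_min_iff, lt_min_iff] at hxq
  obtain ⟨⟨hd1, -⟩, -, hd2⟩ := hxq
  simp only at hd1 hd2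
  refine ⟨pts (i q), ⟨⟨i q, (hn q hq).1, rfl⟩, ?_⟩, ?_⟩
  · have h1 := (abs_lt.1 (hcn (i q) (hn q hq).1)).1
    have h2 := (hn q hq).2
    rw [Real.dist_eq] at hd2
    linarith [(abs_lt.1 hd2).2]
  · linarith [dist_triangle x q.1 (pts (i q)), hi q hq]

lemma edist_le_ofReal_of_dist_le {x y : Space d} (h : dist x y ≤ ε) :
    edist x y ≤ ENNReal.ofReal ε := by
  rw [edist_dist]
  exact ENNReal.ofReal_le_ofReal h

end Deterministic

lemma IsAdmissibleKernel.exists_bounds {d p : ℕ} {K : Space d → ℝ} (hK : IsAdmissibleKernel K p) :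
    Integrable K ∧ Integrable (fun z => K z ^ 2) ∧ (∃ B, ∀ z, |K z| ≤ B) ∧
      ∃ R > 0, ∀ z, R < ‖z‖ → K z = 0 := by
  have hs : HasCompactSupport K := Metric.isCompact_of_isClosed_isBounded (isClosed_tsupport K)
    hK.bounded_support.closure
  have hs2 : HasCompactSupport fun z => K z ^ 2 := hs.comp_left (g := fun r : ℝ => r ^ 2) (by simp)
  obtain ⟨R, hR0, hR⟩ := hK.bounded_support.exists_pos_norm_le
  refine ⟨hK.continuous.integrable_of_hasCompactSupport hs,
    (hK.continuous.pow 2).integrable_of_hasCompactSupport hs2,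
    hK.continuous.bounded_above_of_compact_support hs, R, hR0, fun z hz => ?_⟩
  by_contra h
  exact absurd (hR z h) (not_le.2 hz)

theorem ae_eventually_iSup_hausdorffEDist_le {d p : ℕ} (hp : 1 ≤ p) {f : Space d → ℝ}
    (hf : IsDensity f) {l u : ℝ} (hA : RegularLevels f p l u) (hl : 0 < l)
    (hbdd : Bornology.IsBounded (levelSet f l)) {K : Space d → ℝ} (hK : IsAdmissibleKernel K p)
    (hKf : (∀ z, 0 ≤ K z) ∨ UniformContinuousOn f (levelSet f l)ᶜ) {h : ℕ → ℝ}
    (hh : IsAdmissibleBandwidth d p h) {D : ℕ → ℝ} (hD : Tendsto D atTop (nhds 0))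
    (hD0 : ∀ n, 0 ≤ D n) {Ω : Type*} [MeasurableSpace Ω] {P : Measure Ω}
    [IsProbabilityMeasure P] {X : ℕ → Ω → Space d} (hX : ∀ i, Measurable (X i))
    (hmap : ∀ i, P.map (X i) = densityLaw f) (hind : iIndepFun X P) {ε : ℝ} (hε : 0 < ε) :
    ∀ᵐ ω ∂P, ∀ᶠ n : ℕ in atTop, (⨆ t ∈ Icc l u, Metric.hausdorffEDist (levelSet f t)
      (plusSample K (h n) (D n) n (fun i => X i ω) t)) ≤ ENNReal.ofReal ε := by
  obtain ⟨hKi, hK2, ⟨B, hB⟩, R, hR0, hR⟩ := hK.exists_bounds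
  have hh0 := hh.tendsto_zero hp
  have hleb : ∀ᵐ ω ∂P, ∀ i, Tendsto (fun n => smoothed K f (h n) (X i ω)) atTop
      (nhds (f (X i ω))) := ae_all_iff.2 fun i => by
    refine ae_of_ae_map (p := fun x => Tendsto (fun n => smoothed K f (h n) x) atTop
      (nhds (f x))) (hX i).aemeasurable ?_
    rw [hmap]
    exact (withDensity_absolutelyContinuous _ _).ae_le
      (ae_tendsto_smoothed hK.continuous hKi hK.order.1 hB hR0 hR hf.integrable hh0 hh.1)
  -- Countably many tolerances `1 / (k + 1)` leave a single null set for all `δ`.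
  have hconc : ∀ᵐ ω ∂P, ∀ k : ℕ, ∀ᶠ n in atTop, ∀ i < n,
      |kernelEstimator K (h n) n (fun i => X i ω) (X i ω) - smoothed K f (h n) (X i ω)|
        < 1 / ((k : ℝ) + 1) := ae_all_iff.2 fun k =>
    ae_eventually_abs_kernelEstimator_sub_smoothed_lt hp hf hA.bddAbove hK.continuous hK2 hB hh hX
      hmap hind (by positivity)
  obtain ⟨δ, hδ, hupper⟩ := eventually_smoothed_add_le hp hf.integrable hA hK.continuous hKi
    hK.order.1 hB hR hKf hh0 hh.1 hε
  filter_upwards [hleb, hconc, ae_forall_isOpen_exists_mem hf hX hmap hind] with ω hleb hconc hdense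
  replace hconc : ∀ δ > 0, ∀ᶠ n in atTop, ∀ i < n,
      |kernelEstimator K (h n) n (fun i => X i ω) (X i ω) - smoothed K f (h n) (X i ω)| < δ := by
    intro δ hδ
    obtain ⟨k, hk⟩ := exists_nat_one_div_lt hδ
    filter_upwards [hconc k] with n hn i hi using (hn i hi).trans hk
  filter_upwards [eventually_exists_close_sample hp hA hl hbdd hD hdense hleb hconc hε, hconc δ hδ,
    hupper] with n hclose hcn hup
  refine iSup₂_le fun t ht => Metric.hausdorffEDist_le_of_mem_edist (fun x hx => ?_) fun x hx => ?_
  · obtain ⟨y, hy, hxy⟩ := hclose t ht x hx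
    exact ⟨y, hy, edist_le_ofReal_of_dist_le hxy⟩
  · obtain ⟨⟨i, hi, rfl⟩, hval⟩ := hx
    by_contra! hfar
    have h1 := hup t ht (X i ω) fun y hy => by
      by_contra! hty
      exact absurd (edist_le_ofReal_of_dist_le hy) (not_le.2 (hfar y hty))
    -- The estimator is below `t`, whereas selection requires at least `t + D n ≥ t`.
    linarith [(abs_lt.1 (hcn i hi)).2, hD0 n]

end LevelSetEstimation

theorem corollary2p1 {d p : ℕ} (hp : 1 ≤ p) (f : LevelSetEstimation.Space d → ℝ)
    (hf : LevelSetEstimation.IsDensity f) (l u : ℝ)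
    (hA : LevelSetEstimation.RegularLevels f p l u)
    (hG : ∀ t ∈ Set.Icc l u, IsCompact (LevelSetEstimation.levelSet f t) ∧
      (LevelSetEstimation.levelSet f t).Nonempty ∧
      ¬ Convex ℝ (LevelSetEstimation.levelSet f t))
    (K : LevelSetEstimation.Space d → ℝ)
    (hK : LevelSetEstimation.IsAdmissibleKernel K p)
    (hKf : (∀ z, 0 ≤ K z) ∨
      UniformContinuousOn f (LevelSetEstimation.levelSet f l)ᶜ)
    (h : ℕ → ℝ) (hh : LevelSetEstimation.IsAdmissibleBandwidth d p h) :
    ∃ M₀ : ℝ, 0 < M₀ ∧ ∀ M : ℝ, M₀ ≤ M →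
      ∀ (Ω : Type*) [MeasurableSpace Ω] (P : Measure Ω) [IsProbabilityMeasure P]
        (X : ℕ → Ω → LevelSetEstimation.Space d),
        (∀ i, HasLaw (X i) (LevelSetEstimation.densityLaw f) P) → iIndepFun X P →
        ∀ ε : ℝ, 0 < ε →
          ∀ᵐ ω ∂P, ∀ᶠ n : ℕ in atTop,
            (⨆ t ∈ Set.Icc l u,
              Metric.hausdorffEDist (LevelSetEstimation.levelSet f t)
                (LevelSetEstimation.plusSample K (h n)
                  (LevelSetEstimation.thresholdShift d p M n) n (fun i => X i ω) t))
              ≤ ENNReal.ofReal ε := by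
  have hl := hG l ⟨le_rfl, hA.le⟩
  -- For `l ≤ 0` the level set would be the whole space, which is convex.
  have hl0 : 0 < l := by
    by_contra! hle
    refine hl.2.2 ?_
    rw [(eq_univ_of_forall fun x => hle.trans (hf.nonneg x) :
      LevelSetEstimation.levelSet f l = univ)]
    exact convex_univ
  -- Any positive `M₀` would serve, as only the sign and the limit of `D_n` enter.
  refine ⟨1, one_pos, fun M hM Ω _ P _ X hlaw hind ε hε => ?_⟩
  -- `HasLaw` gives only almost everywhere measurability, so measurable versions are used.
  let Y : ℕ → Ω → LevelSetEstimation.Space d := fun i => (hlaw i).aemeasurable.mk (X i)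
  have hXY : ∀ i, X i =ᵐ[P] Y i := fun i => (hlaw i).aemeasurable.ae_eq_mk
  have key := LevelSetEstimation.ae_eventually_iSup_hausdorffEDist_le hp hf hA hl0
    hl.1.isBounded hK hKf hh (LevelSetEstimation.tendsto_thresholdShift (d := d) hp M)
    (LevelSetEstimation.thresholdShift_nonneg (by linarith)) (P := P) (X := Y)
    (fun i => (hlaw i).aemeasurable.measurable_mk)
    (fun i => (Measure.map_congr (hXY i)).symm.trans (hlaw i).map_eq)
    (hind.congr hXY) hε
  filter_upwards [key, ae_all_iff.2 hXY] with ω hω hωXY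
  simpa only [hωXY] using hω
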